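/- Let $\lambda>0$, $p\in(0,1]$ and $n\ge 0$. Let $\Phi=\sum_i\varepsilon_{X_i}$ be a homogeneous Poisson point process of intensity $\lambda$ on $\mathbb{R}^2$, whose points carry iid marks $\mathbf Z_i=(Z_{i,1},\dots,Z_{i,n})\in\{0,1\}^n$, independent of $\Phi$, with independent $\mathrm{Ber}(p)$ coordinates. Let $\mathbb{P}^{\mathbf 0}$ be the Palm probability of this stationary marked point process, given a point at the origin, and let $\mathbb{P}^{(\mathbf 0,\mathbf 1)}$ be $\mathbb{P}^{\mathbf 0}$ conditioned on the point at the origin having mark $\mathbf 1=(1,\dots,1)$. For each packet $j\in\{1,\dots,n\}$ let $\Phi_j^+$ and $\Phi_j^-$ be the sets of points whose $j$-th mark coordinate is $1$ and $0$, respectively. Let $C_j^+$ be the infinite cluster of the graph on $\Phi_j^+$ that joins distinct points at Euclidean distance at most $1$, that is, the set of the vertices whose connected component is infinite (if $\lambda p$ exceeds the critical intensity $\lambda_c$, this is almost surely the unique infinite connected component). The infinite extended cluster (IEC) of packet $j$ is $$C_j^{\mathrm{ext}}=C_j^+\cup\{v\in\Phi_j^- : B_1(v)\cap C_j^+\neq\emptyset\},$$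 where $B_1(v)$ is the closed unit ball around $v$. For $k\ge 0$ let $C_{k,n}^{\mathrm{ext}}$ be the set of points of the process that lie in at least $k$ of the $n$ IECs, and put $\theta_{k,n}^{\mathrm{ext}}=\mathbb{P}^{\mathbf 0}(\mathbf 0\in C_{k,n}^{\mathrm{ext}})$. For $T\subseteq[n]=\{1,\dots,n\}$ let $A_T^{\mathrm{ext}}$ be the event that the origin is in the IEC of packet $j$ for exactly those $j$ that belong to $T$, and let $[t]=\{1,\dots,t\}$. Then, for every $0\le t\le n$ and every $T\subseteq[n]$ with $|T|=t$, $$\mathbb{P}^{(\mathbf 0,\mathbf 1)}\big(A_{T}^{\mathrm{ext}}\big)=\mathbb{P}^{(\mathbf 0,\mathbf 1)}\big(A_{[t]}^{\mathrm{ext}}\big)=\begin{cases}\dfrac{\theta_{t,n}^{\mathrm{ext}}-\theta_{t+1,n}^{\mathrm{ext}}}{\binom nt}, & 0\le t\le n-1,\\[2mm] \theta_{n,n}^{\mathrm{ext}}, & t=n.\end{cases}$$ -/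

import Mathlib

open MeasureTheory ProbabilityTheory
open scoped NNReal ENNReal unitInterval

noncomputable section

namespace Forwarding

/-- The Euclidean plane. -/
abbrev Plane : Type := EuclideanSpace ℝ (Fin 2)

/-- Mark vectors `(z_1, …, z_n) ∈ {0,1}^n`, with `true` for `1` (the node transmits the packet). -/
abbrev Mark (n : ℕ) : Type := Fin n → Bool

/-! ### Deterministic part: random geometric graphs and extended clusters -/

/-- The random geometric graph with vertex set `S` and distance threshold `1`. It is written as a
graph on the whole plane in which the points outside `S` are isolated. -/
def rgg (S : Set Plane) : SimpleGraph Plane where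
  Adj x y := x ∈ S ∧ y ∈ S ∧ x ≠ y ∧ dist x y ≤ 1
  symm.symm _ _ h := ⟨h.2.1, h.1, h.2.2.1.symm, by rw [dist_comm]; exact h.2.2.2⟩
  loopless.irrefl _ h := h.2.2.1 rfl

/-- The connected component (cluster) of the vertex `x` in the random geometric graph on `S`. -/
def cluster (S : Set Plane) (x : Plane) : Set Plane :=
  {y | y ∈ S ∧ (rgg S).Reachable x y}

/-- The infinite cluster of the random geometric graph on `S`: the vertices whose cluster is
infinite. It is empty if there is no infinite cluster. -/
def infiniteCluster (S : Set Plane) : Set Plane :=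
  {x | x ∈ S ∧ (cluster S x).Infinite}

/-- The points of the marked configuration `φ` with mark `1` for the packet `j`. -/
def plusPart {n : ℕ} (φ : Set (Plane × Mark n)) (j : Fin n) : Set Plane :=
  {x | ∃ z : Mark n, (x, z) ∈ φ ∧ z j = true}

/-- The points of the marked configuration `φ` with mark `0` for the packet `j`. -/
def minusPart {n : ℕ} (φ : Set (Plane × Mark n)) (j : Fin n) : Set Plane :=
  {x | ∃ z : Mark n, (x, z) ∈ φ ∧ z j = false}

/-- The boundary of a set `S` of transmitting nodes of the packet `j`: the nodes that do not
transmit the packet and have a point of `S` in their closed unit ball. -/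
def boundary {n : ℕ} (φ : Set (Plane × Mark n)) (j : Fin n) (S : Set Plane) : Set Plane :=
  {v | v ∈ minusPart φ j ∧ (Metric.closedBall v 1 ∩ S).Nonempty}

/-- The infinite extended cluster (IEC) of the packet `j`. -/
def iec {n : ℕ} (φ : Set (Plane × Mark n)) (j : Fin n) : Set Plane :=
  infiniteCluster (plusPart φ j) ∪ boundary φ j (infiniteCluster (plusPart φ j))

/-- The nodes which are in at least `k` of the `n` IECs. -/
def extAtLeast {n : ℕ} (φ : Set (Plane × Mark n)) (k : ℕ) : Set Plane :=
  {x | k ≤ {j : Fin n | x ∈ iec φ j}.ncard}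

/-! ### Probabilistic part: Poisson processes, iid marks, Palm probability -/

/-- The number of points of the sequence `X` in the set `B`. -/
def count {Ω : Type*} (X : ℕ → Ω → Plane) (B : Set Plane) (ω : Ω) : ℕ∞ :=
  {i : ℕ | X i ω ∈ B}.encard

/-- `Φ = ∑ i, ε_{X i}` is a homogeneous Poisson point process of intensity `lam` on the plane:
the number of points in a Borel set of finite area is Poisson with mean `lam` times the area, and
the numbers of points in finitely many disjoint Borel sets are independent. -/
structure IsPoissonProcess {Ω : Type*} [MeasurableSpace Ω] (P : Measure Ω) (lam : ℝ≥0)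
    (X : ℕ → Ω → Plane) : Prop where
  measurable : ∀ i, Measurable (X i)
  law : ∀ B : Set Plane, MeasurableSet B → volume B ≠ ∞ → ∀ k : ℕ,
    P {ω | count X B ω = k} = poissonMeasure (lam * (volume B).toNNReal) {k}
  indep : ∀ (m : ℕ) (B : Fin m → Set Plane), (∀ i, MeasurableSet (B i)) →
    Pairwise (fun i j => Disjoint (B i) (B j)) → iIndepFun (fun i => count X (B i)) P

/-- The law of the mark of a node: `n` independent `Ber(p)` coordinates. -/
def markLaw (n : ℕ) (p : I) : Measure (Mark n) :=
  Measure.pi fun _ => bernoulliMeasure true false p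

/-- `∑ i, ε_{(X i, Z i)}` is an iid marked Poisson process with intensity `lam` and mark
distribution `markLaw n p`: the marks are iid, and independent of the points. -/
structure IsMarkedPoissonProcess {Ω : Type*} [MeasurableSpace Ω] (P : Measure Ω) (lam : ℝ≥0)
    {n : ℕ} (p : I) (X : ℕ → Ω → Plane) (Z : ℕ → Ω → Mark n) : Prop where
  poisson : IsPoissonProcess P lam X
  measurable_mark : ∀ i, Measurable (Z i)
  law_mark : ∀ i, P.map (Z i) = markLaw n p
  iIndep_mark : iIndepFun Z P
  indep_points : IndepFun (fun ω i => X i ω) (fun ω i => Z i ω) P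

/-- Enumerated marked configurations; such a sequence `s` stands for the set `Set.range s` of
marked points. -/
abbrev Config (n : ℕ) : Type := ℕ → Plane × Mark n

/-- The unit square `[-1/2, 1/2]²`. -/
def unitSquare : Set Plane := {x | ∀ i, x i ∈ Set.Icc (-(1 / 2) : ℝ) (1 / 2)}

/-- The Palm probability `P⁰` of the stationary marked point process `∑ i, ε_{(X i, Z i)}` of
intensity `lam`, as a law on pairs (mark of the point at the origin, marked configuration):
`P⁰(A) = lam⁻¹ * E[∑_{i : X i ∈ [-1/2,1/2]²} 1_A (Z i, configuration shifted by - X i)]`. -/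
def palm {Ω : Type*} [MeasurableSpace Ω] (P : Measure Ω) (lam : ℝ≥0) {n : ℕ}
    (X : ℕ → Ω → Plane) (Z : ℕ → Ω → Mark n) : Measure (Mark n × Config n) :=
  (lam : ℝ≥0∞)⁻¹ • Measure.sum fun i =>
    (P.restrict {ω | X i ω ∈ unitSquare}).map
      fun ω => (Z i ω, fun j => (X j ω - X i ω, Z j ω))

/-- The Palm probability `P^{(0,1)}`, conditional on the origin having mark `(1, …, 1)`. -/
def palmOne {Ω : Type*} [MeasurableSpace Ω] (P : Measure Ω) (lam : ℝ≥0) {n : ℕ}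
    (X : ℕ → Ω → Plane) (Z : ℕ → Ω → Mark n) : Measure (Mark n × Config n) :=
  ProbabilityTheory.cond (palm P lam X Z) {q | q.1 = fun _ => true}

/-- `θ^ext_{k,n}`: the Palm probability `P⁰` that the origin is in at least `k` of the `n` IECs. -/
def thetaExt {Ω : Type*} [MeasurableSpace Ω] (P : Measure Ω) (lam : ℝ≥0) {n : ℕ}
    (X : ℕ → Ω → Plane) (Z : ℕ → Ω → Mark n) (k : ℕ) : ℝ :=
  (palm P lam X Z).real {q | (0 : Plane) ∈ extAtLeast (Set.range q.2) k}

/-- `A^ext_T`: the origin is in exactly the IECs of the packets in `T`. -/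
def extEvent {n : ℕ} (T : Finset (Fin n)) : Set (Mark n × Config n) :=
  {q | ∀ j : Fin n, (0 : Plane) ∈ iec (Set.range q.2) j ↔ j ∈ T}

/-- The first `t` packets (the packets are numbered from `0` to `n - 1` here). -/
def firstPackets (n t : ℕ) : Finset (Fin n) := Finset.univ.filter fun j => (j : ℕ) < t

end Forwarding

end

/-!
Since degrees are finite, a node belongs to the infinite extended cluster of a packet if and only if
its unit ball meets an infinite cluster of the *other* transmitting nodes: if the node transmits,
deleting it splits its infinite component into finitely many pieces, one of which is infinite. Hence
the set `S` of packets whose extended cluster contains the origin does not depend on the mark of the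
origin, and conditioning this mark on being `(1, …, 1)` does not change the law of `S` under `P⁰`.
The law of a mark is invariant under permutations of the packets, so `P⁰(S = T)` depends only on the
size of `T`, and `θ_t - θ_{t+1} = P⁰(|S| = t)` is the sum of `n.choose t` equal terms.

The points of a Poisson process are almost surely distinct because `P(X i ∈ B, X j ∈ B)` is at most
quadratic in the area of `B`.
-/

namespace Forwarding

section Reachability

variable {V : Type*} {G : SimpleGraph V} {v : V}

theorem reachable_iff_eq_or_exists_reachable_deleteIncidenceSet {w : V} :
    G.Reachable v w ↔ w = v ∨ ∃ y, G.Adj v y ∧ (G.deleteIncidenceSet v).Reachable y w := by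
  constructor
  · intro h
    rw [SimpleGraph.reachable_iff_reflTransGen] at h
    induction h with
    | refl => exact .inl rfl
    | @tail b c _ hbc ih =>
      by_cases hc : c = v
      · exact .inl hc
      by_cases hb : b = v
      · exact .inr ⟨c, hb ▸ hbc, .refl c⟩
      obtain ⟨y, hvy, hyb⟩ := ih.resolve_left hb
      exact .inr ⟨y, hvy, hyb.trans
        (SimpleGraph.deleteIncidenceSet_adj.2 ⟨hbc, hb, hc⟩).reachable⟩
  · rintro (rfl | ⟨y, hvy, hyw⟩)
    · exact .refl _
    · exact hvy.reachable.trans (hyw.mono (G.deleteIncidenceSet_le v))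

theorem infinite_setOf_reachable_iff (hfin : (G.neighborSet v).Finite) :
    {w | G.Reachable v w}.Infinite ↔
      ∃ y, G.Adj v y ∧ {w | (G.deleteIncidenceSet v).Reachable y w}.Infinite := by
  have hcover : {w | G.Reachable v w} =
      insert v (⋃ y ∈ G.neighborSet v, {w | (G.deleteIncidenceSet v).Reachable y w}) := by
    ext w
    rw [Set.mem_ofPred_eq, reachable_iff_eq_or_exists_reachable_deleteIncidenceSet]
    simp
  contrapose!
  rw [hcover, Set.finite_insert]
  exact ⟨fun h y hy => h.subset (Set.subset_biUnion_of_mem (s := G.neighborSet v)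
    (u := fun y => {w | (G.deleteIncidenceSet v).Reachable y w}) hy), hfin.biUnion⟩

end Reachability

theorem rgg_sdiff_singleton (S : Set Plane) (v : Plane) :
    rgg (S \ {v}) = (rgg S).deleteIncidenceSet v := by
  ext x y
  simp only [rgg, SimpleGraph.deleteIncidenceSet_adj, Set.mem_sdiff, Set.mem_singleton_iff]
  tauto

theorem mem_infiniteCluster_iff {S : Set Plane} {x : Plane} :
    x ∈ infiniteCluster S ↔ x ∈ S ∧ {y | (rgg S).Reachable x y}.Infinite := by
  refine and_congr_right fun hx => ?_
  suffices cluster S x = {y | (rgg S).Reachable x y} by rw [this]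
  refine Set.Subset.antisymm (fun y hy => hy.2) fun y hy => ⟨?_, hy⟩
  rw [Set.mem_ofPred_eq, SimpleGraph.reachable_iff_reflTransGen] at hy
  rcases hy.cases_tail with rfl | ⟨_, _, hadj⟩
  exacts [hx, hadj.2.1]

theorem mem_infiniteCluster_iff_nonempty {S : Set Plane} {v : Plane} (hv : v ∈ S)
    (hfin : (S \ {v} ∩ Metric.closedBall v 1).Finite) :
    v ∈ infiniteCluster S ↔ (Metric.closedBall v 1 ∩ infiniteCluster (S \ {v})).Nonempty := by
  have hadj : ∀ y, (rgg S).Adj v y ↔ y ∈ S \ {v} ∩ Metric.closedBall v 1 := fun y => by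
    simp only [rgg, hv, true_and, Set.mem_inter_iff, Set.mem_sdiff, Set.mem_singleton_iff,
      Metric.mem_closedBall', and_assoc, eq_comm]
  have hnbr : ((rgg S).neighborSet v).Finite := by
    simpa only [SimpleGraph.neighborSet, hadj, Set.ofPred_mem_eq] using hfin
  rw [mem_infiniteCluster_iff, and_iff_right hv, infinite_setOf_reachable_iff hnbr,
    ← rgg_sdiff_singleton]
  refine exists_congr fun y => ?_
  rw [hadj, Set.mem_inter_iff, Set.mem_inter_iff, mem_infiniteCluster_iff]
  tauto

section ExtendedCluster

variable {n : ℕ} {φ φ' : Set (Plane × Mark n)} {v : Plane} {j : Fin n}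

theorem mem_iec_iff_nonempty (hv : ∃! z, (v, z) ∈ φ)
    (hfin : (plusPart φ j \ {v} ∩ Metric.closedBall v 1).Finite) :
    v ∈ iec φ j ↔
      (Metric.closedBall v 1 ∩ infiniteCluster (plusPart φ j \ {v})).Nonempty := by
  obtain ⟨z, hz, huniq⟩ := hv
  have hplus : v ∈ plusPart φ j ↔ z j = true :=
    ⟨fun ⟨z', hz', hj⟩ => huniq z' hz' ▸ hj, fun hj => ⟨z, hz, hj⟩⟩
  have hminus : v ∈ minusPart φ j ↔ z j = false :=
    ⟨fun ⟨z', hz', hj⟩ => huniq z' hz' ▸ hj, fun hj => ⟨z, hz, hj⟩⟩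
  cases hj : z j
  · have hv : v ∉ plusPart φ j := by simp [hplus, hj]
    rw [Set.sdiff_singleton_eq_self hv]
    simp [iec, boundary, infiniteCluster, hv, hminus, hj]
  · rw [← mem_infiniteCluster_iff_nonempty (hplus.2 hj) hfin]
    simp [iec, boundary, hminus, hj]

theorem mem_iec_congr (hv : ∃! z, (v, z) ∈ φ) (hv' : ∃! z, (v, z) ∈ φ')
    (h : ∀ x ≠ v, ∀ z, (x, z) ∈ φ ↔ (x, z) ∈ φ')
    (hfin : (plusPart φ j \ {v} ∩ Metric.closedBall v 1).Finite) :
    v ∈ iec φ j ↔ v ∈ iec φ' j := by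
  have hplus : plusPart φ j \ {v} = plusPart φ' j \ {v} := by
    ext x
    refine and_congr_left fun hx => exists_congr fun z => ?_
    rw [h x hx z]
  rw [mem_iec_iff_nonempty hv hfin, mem_iec_iff_nonempty hv' (hplus ▸ hfin), hplus]

theorem iec_image_comp_perm (e : Equiv.Perm (Fin n)) (φ : Set (Plane × Mark n)) (j : Fin n) :
    iec (Prod.map id (fun z => z ∘ e) '' φ) j = iec φ (e j) := by
  have hplus : plusPart (Prod.map id (fun z => z ∘ e) '' φ) j = plusPart φ (e j) := by
    ext x
    simp [plusPart, Prod.map]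
  have hminus : minusPart (Prod.map id (fun z => z ∘ e) '' φ) j = minusPart φ (e j) := by
    ext x
    simp [minusPart, Prod.map]
  simp only [iec, boundary, hplus, hminus]

/-- The set of the packets whose infinite extended cluster in `φ` contains the point `x`. -/
noncomputable def iecPackets (φ : Set (Plane × Mark n)) (x : Plane) : Finset (Fin n) :=
  {j : Fin n | x ∈ iec φ j}.toFinite.toFinset

theorem mem_iecPackets {x : Plane} : j ∈ iecPackets φ x ↔ x ∈ iec φ j := by
  simp [iecPackets]

theorem mem_extEvent_iff {T : Finset (Fin n)} {q : Mark n × Config n} :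
    q ∈ extEvent T ↔ iecPackets (Set.range q.2) 0 = T := by
  simp [extEvent, Finset.ext_iff, mem_iecPackets]

theorem mem_extAtLeast_iff {x : Plane} {k : ℕ} :
    x ∈ extAtLeast φ k ↔ k ≤ (iecPackets φ x).card := by
  rw [extAtLeast, Set.mem_ofPred_eq, iecPackets, Set.ncard_eq_toFinset_card]

theorem iecPackets_image_comp_perm (e : Equiv.Perm (Fin n)) (φ : Set (Plane × Mark n))
    (x : Plane) :
    (iecPackets (Prod.map id (fun z => z ∘ e) '' φ) x).map e.toEmbedding = iecPackets φ x := by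
  ext j
  simp [mem_iecPackets, iec_image_comp_perm]

end ExtendedCluster

section SeenFrom

variable {n : ℕ} {x : ℕ → Plane} {i : ℕ}

/-- The enumerated configuration with points `x k` and marks `z k`, seen from its point `x i`: the
mark of this point, paired with the configuration translated so that this point is the origin. -/
def seenFrom (x : ℕ → Plane) (z : ℕ → Mark n) (i : ℕ) : Mark n × Config n :=
  (z i, fun k => (x k - x i, z k))

theorem mem_range_seenFrom {z : ℕ → Mark n} {q : Plane × Mark n} :
    q ∈ Set.range (seenFrom x z i).2 ↔ ∃ k, x k - x i = q.1 ∧ z k = q.2 := by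
  simp [seenFrom, Prod.ext_iff]

theorem existsUnique_zero_mem_range_seenFrom (hx : Function.Injective x) (z : ℕ → Mark n) :
    ∃! a, ((0 : Plane), a) ∈ Set.range (seenFrom x z i).2 := by
  refine ⟨z i, mem_range_seenFrom.2 ⟨i, sub_self _, rfl⟩, fun a ha => ?_⟩
  obtain ⟨k, hk, rfl⟩ := mem_range_seenFrom.1 ha
  rw [hx (sub_eq_zero.1 hk)]

theorem finite_plusPart_seenFrom_inter_closedBall
    (hfin : {k | x k ∈ Metric.closedBall (x i) 1}.Finite) (z : ℕ → Mark n) (j : Fin n) :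
    (plusPart (Set.range (seenFrom x z i).2) j ∩ Metric.closedBall 0 1).Finite := by
  refine (hfin.image fun k => x k - x i).subset ?_
  rintro _ ⟨⟨a, ha, -⟩, hy⟩
  obtain ⟨k, rfl, -⟩ := mem_range_seenFrom.1 ha
  exact ⟨k, by simpa [dist_eq_norm] using hy, rfl⟩

theorem iecPackets_seenFrom_update (hx : Function.Injective x)
    (hfin : {k | x k ∈ Metric.closedBall (x i) 1}.Finite) (z : ℕ → Mark n) (a : Mark n) :
    iecPackets (Set.range (seenFrom x (Function.update z i a) i).2) 0 =
      iecPackets (Set.range (seenFrom x z i).2) 0 := by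
  ext j
  rw [mem_iecPackets, mem_iecPackets]
  refine mem_iec_congr (existsUnique_zero_mem_range_seenFrom hx _)
    (existsUnique_zero_mem_range_seenFrom hx _) (fun y hy b => ?_)
    ((finite_plusPart_seenFrom_inter_closedBall hfin _ j).subset
      (Set.inter_subset_inter_left _ Set.sdiff_subset))
  simp only [mem_range_seenFrom]
  refine exists_congr fun k => and_congr_right fun hk => ?_
  have hki : k ≠ i := fun h => hy (by rw [← hk, h, sub_self])
  rw [Function.update_of_ne hki]

theorem map_iecPackets_seenFrom_comp_perm (e : Equiv.Perm (Fin n)) (z : ℕ → Mark n) :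
    (iecPackets (Set.range (seenFrom x (fun k => z k ∘ e) i).2) 0).map e.toEmbedding =
      iecPackets (Set.range (seenFrom x z i).2) 0 := by
  rw [← iecPackets_image_comp_perm e (Set.range (seenFrom x z i).2), ← Set.range_comp]
  rfl

end SeenFrom

section Measurability

variable {Ω : Type*} [MeasurableSpace Ω]

theorem measurable_isChain {V : Type*} {r : Ω → V → V → Prop}
    (hr : ∀ a b, Measurable fun ω => r ω a b) (l : List V) :
    Measurable fun ω => l.IsChain (r ω) := by
  induction l with
  | nil => simp
  | cons a l ih =>
    cases l with
    | nil => simp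
    | cons b l =>
      simp only [List.isChain_cons_cons]
      exact (hr a b).and ih

theorem measurable_reflTransGen {V : Type*} [Countable V] {r : Ω → V → V → Prop}
    (hr : ∀ a b, Measurable fun ω => r ω a b) (a b : V) :
    Measurable fun ω => Relation.ReflTransGen (r ω) a b := by
  have hpath : ∀ ω, Relation.ReflTransGen (r ω) a b ↔
      ∃ l : List V, (a :: l).IsChain (r ω) ∧ (a :: l).getLast (List.cons_ne_nil _ _) = b :=
    fun ω => ⟨List.exists_isChain_cons_of_relationReflTransGen, fun ⟨l, hl, hlast⟩ =>
      List.relationReflTransGen_of_exists_isChain_cons l hl hlast⟩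
  simp only [hpath]
  exact .exists fun l => (measurable_isChain hr _).and measurable_const

theorem reflTransGen_iff_reflTransGen_index {ι α : Type*} {r : α → α → Prop} {u : ι → α}
    (hu : ∀ x y, r x y → y ∈ Set.range u) (a b : ι) :
    Relation.ReflTransGen r (u a) (u b) ↔
      Relation.ReflTransGen (fun i j => u i = u j ∨ r (u i) (u j)) a b := by
  constructor
  · intro h
    generalize hy : u b = y at h
    induction h generalizing b with
    | refl => exact .single (.inl hy.symm)
    | @tail c y hac hcy ih =>
      obtain ⟨k, rfl⟩ : c ∈ Set.range u := by
        rcases hac.cases_tail with rfl | ⟨_, _, h⟩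
        exacts [⟨a, rfl⟩, hu _ _ h]
      exact (ih k rfl).tail (.inr (hy ▸ hcy))
  · intro h
    induction h with
    | refl => exact .refl
    | tail _ hbc ih =>
      rcases hbc with heq | hadj
      exacts [heq ▸ ih, ih.tail hadj]

theorem infinite_iff_forall_finset_exists {ι α : Type*} {u : ι → α} {C : Set α}
    (hC : C ⊆ Set.range u) :
    C.Infinite ↔ ∀ F : Finset ι, ∃ k, u k ∈ C ∧ ∀ l ∈ F, u k ≠ u l := by
  classical
  constructor
  · intro h F
    obtain ⟨y, hy, hyF⟩ := h.exists_notMem_finite (F.finite_toSet.image u)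
    obtain ⟨k, rfl⟩ := hC hy
    exact ⟨k, hy, fun l hl hkl => hyF ⟨l, hl, hkl.symm⟩⟩
  · intro h hfin
    lift C to Finset α using hfin
    obtain ⟨F, -, rfl⟩ := Finset.subset_set_image_iff.1 (Set.image_univ (f := u) ▸ hC)
    obtain ⟨k, hk, hkF⟩ := h F
    obtain ⟨l, hl, hlk⟩ := Finset.mem_image.1 (Finset.mem_coe.1 hk)
    exact hkF l hl hlk.symm

theorem measurable_infinite_setOf_reachable {ι α : Type*} [Countable ι] {u : ι → Ω → α}
    {G : Ω → SimpleGraph α} (hu : ∀ ω x y, (G ω).Adj x y → y ∈ Set.range fun i => u i ω)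
    (heq : ∀ i j, Measurable fun ω => u i ω = u j ω)
    (hadj : ∀ i j, Measurable fun ω => (G ω).Adj (u i ω) (u j ω)) (a : ι) :
    Measurable fun ω => {w | (G ω).Reachable (u a ω) w}.Infinite := by
  have hrange : ∀ ω, {w | (G ω).Reachable (u a ω) w} ⊆ Set.range fun i => u i ω := fun ω w hw => by
    rw [Set.mem_ofPred_eq, SimpleGraph.reachable_iff_reflTransGen] at hw
    rcases hw.cases_tail with rfl | ⟨_, _, h⟩
    exacts [⟨a, rfl⟩, hu ω _ _ h]
  have hreach : ∀ k, Measurable fun ω => (G ω).Reachable (u a ω) (u k ω) := fun k => by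
    simp only [SimpleGraph.reachable_iff_reflTransGen,
      reflTransGen_iff_reflTransGen_index (hu _)]
    exact measurable_reflTransGen (fun i j => (heq i j).or (hadj i j)) a k
  simp only [infinite_iff_forall_finset_exists (hrange _), Set.mem_ofPred_eq]
  exact .forall fun F => .exists fun k => (hreach k).and
    (.forall fun l => .forall fun _ => (heq k l).not)

variable {n : ℕ} {s : Config n} {j : Fin n}

theorem mem_plusPart_range_iff {y : Plane} :
    y ∈ plusPart (Set.range s) j ↔ ∃ k, (s k).1 = y ∧ (s k).2 j = true := by
  constructor
  · rintro ⟨z, ⟨k, hk⟩, hz⟩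
    exact ⟨k, by rw [hk], by rw [hk]; exact hz⟩
  · rintro ⟨k, rfl, hz⟩
    exact ⟨_, ⟨k, rfl⟩, hz⟩

theorem mem_minusPart_range_iff {y : Plane} :
    y ∈ minusPart (Set.range s) j ↔ ∃ k, (s k).1 = y ∧ (s k).2 j = false := by
  constructor
  · rintro ⟨z, ⟨k, hk⟩, hz⟩
    exact ⟨k, by rw [hk], by rw [hk]; exact hz⟩
  · rintro ⟨k, rfl, hz⟩
    exact ⟨_, ⟨k, rfl⟩, hz⟩

theorem plusPart_range_subset : plusPart (Set.range s) j ⊆ Set.range fun k => (s k).1 := by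
  intro y hy
  obtain ⟨k, hk, -⟩ := mem_plusPart_range_iff.1 hy
  exact ⟨k, hk⟩

theorem mem_iec_range_iff {y : Plane} :
    y ∈ iec (Set.range s) j ↔
      (∃ k, (s k).1 = y ∧ (s k).1 ∈ infiniteCluster (plusPart (Set.range s) j)) ∨
      (∃ k, (s k).1 = y ∧ (s k).2 j = false) ∧
        ∃ k, dist (s k).1 y ≤ 1 ∧ (s k).1 ∈ infiniteCluster (plusPart (Set.range s) j) := by
  rw [iec, boundary, Set.mem_union, Set.mem_ofPred_eq, mem_minusPart_range_iff]
  refine or_congr ⟨fun hy => ?_, fun ⟨_, hk, h⟩ => hk ▸ h⟩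
    (and_congr_right' ⟨fun ⟨x, hx, h⟩ => ?_, fun ⟨k, hk, h⟩ => ⟨_, hk, h⟩⟩)
  · obtain ⟨k, rfl⟩ := plusPart_range_subset hy.1
    exact ⟨k, rfl, hy⟩
  · obtain ⟨k, rfl⟩ := plusPart_range_subset h.1
    exact ⟨k, hx, h⟩

variable (j)

theorem measurable_mem_plusPart (a : ℕ) :
    Measurable fun s : Config n => (s a).1 ∈ plusPart (Set.range s) j := by
  simp only [mem_plusPart_range_iff]
  exact .exists fun k => (Measurable.eq (by fun_prop) (by fun_prop)).and
    (Measurable.eq_const (by fun_prop) true)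

theorem measurable_rgg_adj (a b : ℕ) :
    Measurable fun s : Config n => (rgg (plusPart (Set.range s) j)).Adj (s a).1 (s b).1 :=
  (measurable_mem_plusPart j a).and <| (measurable_mem_plusPart j b).and <|
    (Measurable.eq (by fun_prop) (by fun_prop)).not.and
      (measurableSet_le (Measurable.dist (by fun_prop) (by fun_prop)) measurable_const).mem

theorem measurable_mem_infiniteCluster (a : ℕ) :
    Measurable fun s : Config n => (s a).1 ∈ infiniteCluster (plusPart (Set.range s) j) := by
  have hinf := measurable_infinite_setOf_reachable (u := fun k (s : Config n) => (s k).1)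
    (G := fun s => rgg (plusPart (Set.range s) j))
    (fun s x y hxy => plusPart_range_subset hxy.2.1)
    (fun _ _ => Measurable.eq (by fun_prop) (by fun_prop)) (measurable_rgg_adj j) a
  simp only [mem_infiniteCluster_iff]
  exact (measurable_mem_plusPart j a).and hinf

theorem measurable_mem_iec (y : Plane) :
    Measurable fun s : Config n => y ∈ iec (Set.range s) j := by
  simp only [mem_iec_range_iff]
  have heq : ∀ k, Measurable fun s : Config n => (s k).1 = y := fun k =>
    Measurable.eq_const (by fun_prop) y
  refine .or (.exists fun k => (heq k).and (measurable_mem_infiniteCluster j k)) <|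
    .and (.exists fun k => (heq k).and (Measurable.eq_const (by fun_prop) false)) <|
    .exists fun k => .and ?_ (measurable_mem_infiniteCluster j k)
  exact (measurableSet_le (Measurable.dist (by fun_prop) (by fun_prop)) measurable_const).mem

theorem measurableSet_iecPackets_eq (y : Plane) (T : Finset (Fin n)) :
    MeasurableSet {q : Mark n × Config n | iecPackets (Set.range q.2) y = T} := by
  simp only [Finset.ext_iff, mem_iecPackets]
  exact (Measurable.forall fun j =>
    ((measurable_mem_iec j y).comp measurable_snd).iff measurable_const).setOf

end Measurability

section Diffuse

variable {α : Type*} [MetricSpace α] [MeasurableSpace α] [BorelSpace α] (μ : Measure α)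
  [IsLocallyFiniteMeasure μ] [NullSingletonClass μ]

theorem tendsto_measure_closedBall_nhdsGT (x : α) :
    Filter.Tendsto (fun r => μ (Metric.closedBall x r)) (nhdsWithin 0 (Set.Ioi 0)) (nhds 0) := by
  obtain ⟨R, hR, hfin⟩ : ∃ R > 0, μ (Metric.closedBall x R) < ∞ := by
    obtain ⟨s, hs, hμs⟩ := μ.finiteAt_nhds x
    obtain ⟨R, hR, hsub⟩ := Metric.nhds_basis_closedBall.mem_iff.1 hs
    exact ⟨R, hR, (measure_mono hsub).trans_lt hμs⟩
  have hlim := (tendsto_measure_cthickening_of_isClosed (μ := μ)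
    ⟨R, hR, by rw [Metric.cthickening_singleton x hR.le]; exact hfin.ne⟩
    (isClosed_singleton (x := x))).mono_left
      (nhdsWithin_le_nhds (s := Set.Ioi 0))
  rw [measure_singleton] at hlim
  refine hlim.congr' ?_
  filter_upwards [self_mem_nhdsWithin] with r hr
  rw [Metric.cthickening_singleton x (le_of_lt hr)]

variable [SecondCountableTopology α] [HasBesicovitchCovering α] {C : ℝ≥0∞}

-- The density of `ν` at `x` is the limit of `ν (closedBall x r) / μ (closedBall x r)`, which is at
-- most `C * μ (closedBall x r)`.
theorem measure_eq_zero_of_le_mul_sq (ν : Measure α) [IsLocallyFiniteMeasure ν] (hC : C ≠ ∞)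
    (hν : ∀ B, MeasurableSet B → μ B ≠ ∞ → ν B ≤ C * μ B ^ 2) : ν = 0 := by
  have hac : ν ≪ μ := .mk fun B hB hμB => by simpa [hμB] using hν B hB (by simp [hμB])
  have hzero : ν.rnDeriv μ =ᵐ[μ] 0 := by
    filter_upwards [Besicovitch.ae_tendsto_rnDeriv ν μ] with x hx
    have hball := tendsto_measure_closedBall_nhdsGT μ x
    have hlim : Filter.Tendsto (fun r => C * μ (Metric.closedBall x r))
        (nhdsWithin 0 (Set.Ioi 0)) (nhds 0) := by
      simpa using ENNReal.Tendsto.const_mul hball (Or.inr hC)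
    refine tendsto_nhds_unique hx (tendsto_of_tendsto_of_tendsto_of_le_of_le'
      tendsto_const_nhds hlim (.of_forall fun _ => zero_le) ?_)
    filter_upwards [hball.eventually_lt_const ENNReal.zero_lt_top] with r hr
    refine ENNReal.div_le_of_le_mul ((hν _ measurableSet_closedBall hr.ne).trans_eq ?_)
    ring
  rw [← Measure.withDensity_rnDeriv_eq ν μ hac, withDensity_congr_ae hzero]
  simp

theorem ae_ne_of_measure_mem_le_mul_sq {Ω : Type*} [MeasurableSpace Ω] {P : Measure Ω}
    [IsFiniteMeasure P] {X Y : Ω → α} (hX : Measurable X) (hC : C ≠ ∞)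
    (h : ∀ B, MeasurableSet B → μ B ≠ ∞ → P {ω | X ω ∈ B ∧ Y ω ∈ B} ≤ C * μ B ^ 2) :
    ∀ᵐ ω ∂P, X ω ≠ Y ω := by
  have hzero : (P.restrict {ω | X ω = Y ω}).map X = 0 := by
    refine measure_eq_zero_of_le_mul_sq μ _ hC fun B hB hμB => (h B hB hμB).trans' ?_
    rw [Measure.map_apply hX hB, Measure.restrict_apply (hX hB)]
    exact measure_mono fun ω ⟨hω, heq⟩ => ⟨hω, (show X ω = Y ω from heq) ▸ hω⟩
  rw [Measure.map_eq_zero_iff hX.aemeasurable, Measure.restrict_eq_zero] at hzero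
  simpa only [ae_iff, not_not] using hzero

end Diffuse

section Poisson

theorem lintegral_natCast_poissonMeasure (r : ℝ≥0) :
    ∫⁻ k : ℕ, (k : ℝ≥0∞) ∂poissonMeasure r = r := by
  have hstep : ∀ k : ℕ, ((k + 1 : ℕ) : ℝ≥0∞) * poissonMeasure r {k + 1} =
      r * poissonMeasure r {k} := by
    intro k
    rw [poissonMeasure_singleton, poissonMeasure_singleton, ← ENNReal.ofReal_natCast,
      ← ENNReal.ofReal_coe_nnreal (p := r), ← ENNReal.ofReal_mul (by positivity),
      ← ENNReal.ofReal_mul (by positivity), Nat.factorial_succ]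
    congr 1
    push_cast
    field_simp
    ring
  have hone : ∑' k : ℕ, poissonMeasure r {k} = 1 := by
    simpa using (lintegral_countable' (μ := poissonMeasure r) fun _ => 1).symm
  rw [lintegral_countable', tsum_eq_zero_add' ENNReal.summable]
  simp_rw [hstep]
  rw [ENNReal.tsum_mul_left, hone]
  simp

theorem poissonMeasure_Ici_two_le (r : ℝ≥0) : poissonMeasure r (Set.Ici 2) ≤ r ^ 2 := by
  have hcompl : Set.Ici 2 = ({0, 1} : Set ℕ)ᶜ := by
    ext k
    simp only [Set.mem_Ici, Set.mem_compl_iff, Set.mem_insert_iff, Set.mem_singleton_iff]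
    omega
  have hpair : (poissonMeasure r).real {0, 1} = Real.exp (-r) * (1 + r) := by
    rw [Set.insert_eq, measureReal_union (by simp) (measurableSet_singleton 1),
      poissonMeasure_real_singleton, poissonMeasure_real_singleton]
    simp only [pow_zero, pow_one, Nat.factorial_zero, Nat.factorial_one, Nat.cast_one]
    ring
  have hreal : (poissonMeasure r).real (Set.Ici 2) ≤ (r : ℝ) ^ 2 := by
    rw [hcompl, probReal_compl_eq_one_sub (.of_discrete), hpair]
    nlinarith [Real.add_one_le_exp (-(r : ℝ)), r.coe_nonneg]
  rw [← ofReal_measureReal]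
  exact (ENNReal.ofReal_le_ofReal hreal).trans_eq
    (by rw [ENNReal.ofReal_pow r.coe_nonneg, ENNReal.ofReal_coe_nnreal])

variable {Ω : Type*} {X : ℕ → Ω → Plane} {B : Set Plane}

theorem count_eq_tsum (X : ℕ → Ω → Plane) (B : Set Plane) (ω : Ω) :
    (count X B ω : ℝ≥0∞) = ∑' i, (X i ⁻¹' B).indicator 1 ω := by
  rw [count, ← ENNReal.tsum_set_one]
  exact tsum_subtype {i | X i ω ∈ B} fun _ => (1 : ℝ≥0∞)

variable [MeasurableSpace Ω] {P : Measure Ω} {lam : ℝ≥0}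

theorem measurable_count (hX : ∀ i, Measurable (X i)) (hB : MeasurableSet B) :
    Measurable (count X B) :=
  measurable_encard.comp (measurable_set_iff.2 fun i => (hX i hB).mem)

theorem lintegral_count (hX : ∀ i, Measurable (X i)) (hB : MeasurableSet B) :
    ∫⁻ ω, (count X B ω : ℝ≥0∞) ∂P = ∑' i, P {ω | X i ω ∈ B} := by
  simp only [count_eq_tsum]
  rw [lintegral_tsum fun i => (measurable_one.indicator (hX i hB)).aemeasurable]
  exact tsum_congr fun i => lintegral_indicator_one (hX i hB)

namespace IsPoissonProcess

variable [IsProbabilityMeasure P]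

theorem map_count (h : IsPoissonProcess P lam X) (hB : MeasurableSet B) (hvol : volume B ≠ ∞) :
    P.map (count X B) = (poissonMeasure (lam * (volume B).toNNReal)).map Nat.cast := by
  have hcount := measurable_count h.measurable hB
  have hcast : MeasurableEmbedding (Nat.cast : ℕ → ℕ∞) :=
    ⟨Nat.cast_injective, .of_discrete, fun _ _ => .of_discrete⟩
  have hcomap : (P.map (count X B)).comap Nat.cast =
      poissonMeasure (lam * (volume B).toNNReal) := Measure.ext_of_singleton fun k => by
    rw [hcast.comap_apply, Set.image_singleton, Measure.map_apply hcount .of_discrete,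
      ← h.law B hB hvol k]
    rfl
  have hprob := Measure.isProbabilityMeasure_map (μ := P) hcount.aemeasurable
  have hprob' := Measure.isProbabilityMeasure_map (f := (Nat.cast : ℕ → ℕ∞))
    (μ := poissonMeasure (lam * (volume B).toNNReal)) (Measurable.of_discrete).aemeasurable
  refine (Measure.eq_of_le_of_isProbabilityMeasure ?_).symm
  rw [← hcomap, hcast.map_comap]
  exact Measure.restrict_le_self

theorem ae_finite_setOf_mem (h : IsPoissonProcess P lam X) (hB : MeasurableSet B)
    (hvol : volume B ≠ ∞) : ∀ᵐ ω ∂P, {i | X i ω ∈ B}.Finite := by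
  have hlt : ∀ᵐ k ∂P.map (count X B), k < ⊤ := by
    rw [h.map_count hB hvol, ae_map_iff (Measurable.of_discrete).aemeasurable .of_discrete]
    exact .of_forall ENat.natCast_lt_top
  filter_upwards [ae_of_ae_map (measurable_count h.measurable hB).aemeasurable hlt] with ω hω
  exact Set.encard_lt_top_iff.1 hω

theorem tsum_measure_mem (h : IsPoissonProcess P lam X) (hB : MeasurableSet B)
    (hvol : volume B ≠ ∞) : ∑' i, P {ω | X i ω ∈ B} = lam * volume B := by
  rw [← lintegral_count h.measurable hB, ← lintegral_map (f := fun k : ℕ∞ => (k : ℝ≥0∞))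
      .of_discrete (measurable_count h.measurable hB), h.map_count hB hvol,
    lintegral_map .of_discrete .of_discrete]
  simp only [ENat.toENNReal_coe]
  rw [lintegral_natCast_poissonMeasure, ENNReal.coe_mul, ENNReal.coe_toNNReal hvol]

theorem measure_two_le_count_le (h : IsPoissonProcess P lam X) (hB : MeasurableSet B)
    (hvol : volume B ≠ ∞) : P {ω | 2 ≤ count X B ω} ≤ lam ^ 2 * volume B ^ 2 := by
  calc P {ω | 2 ≤ count X B ω}
      = P.map (count X B) (Set.Ici (2 : ℕ∞)) := by
        rw [Measure.map_apply (measurable_count h.measurable hB) .of_discrete]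
        rfl
    _ = poissonMeasure (lam * (volume B).toNNReal) (Set.Ici 2) := by
        rw [h.map_count hB hvol, Measure.map_apply .of_discrete .of_discrete]
        congr 1
        ext k
        exact Nat.cast_le (α := ℕ∞) (m := 2)
    _ ≤ lam ^ 2 * volume B ^ 2 := by
        refine (poissonMeasure_Ici_two_le _).trans_eq ?_
        rw [ENNReal.coe_mul, ENNReal.coe_toNNReal hvol, mul_pow]

theorem ae_injective (h : IsPoissonProcess P lam X) :
    ∀ᵐ ω ∂P, Function.Injective fun i => X i ω := by
  have hne : ∀ i j, i ≠ j → ∀ᵐ ω ∂P, X i ω ≠ X j ω := fun i j hij =>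
    ae_ne_of_measure_mem_le_mul_sq (C := lam ^ 2) volume (h.measurable i)
      (ENNReal.pow_ne_top ENNReal.coe_ne_top) fun B hB hvol =>
        (h.measure_two_le_count_le hB hvol).trans' <| measure_mono fun ω ⟨hi, hj⟩ =>
          Order.add_one_le_of_lt (Set.one_lt_encard_iff.2 ⟨i, j, hi, hj, hij⟩)
  simp only [← ae_all_iff] at hne
  filter_upwards [hne] with ω hω i j hij
  exact not_imp_not.1 (hω i j) hij

theorem ae_finite_closedBall (h : IsPoissonProcess P lam X) (r : ℝ) :
    ∀ᵐ ω ∂P, ∀ i, {k | X k ω ∈ Metric.closedBall (X i ω) r}.Finite := by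
  have hfin : ∀ᵐ ω ∂P, ∀ N : ℕ, {k | X k ω ∈ Metric.closedBall 0 N}.Finite :=
    ae_all_iff.2 fun N => h.ae_finite_setOf_mem measurableSet_closedBall
      measure_closedBall_lt_top.ne
  filter_upwards [hfin] with ω hω i
  obtain ⟨N, hN⟩ := exists_nat_ge (r + ‖X i ω‖)
  refine (hω N).subset fun k hk => Metric.closedBall_subset_closedBall' ?_ hk
  simpa using hN

end IsPoissonProcess

theorem measurableSet_unitSquare : MeasurableSet unitSquare := by
  simp only [unitSquare, Set.ofPred_forall]
  exact MeasurableSet.iInter fun i =>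
    (show Measurable fun x : Plane => x i by fun_prop) measurableSet_Icc

theorem volume_unitSquare : volume unitSquare = 1 := by
  have h : unitSquare = (WithLp.ofLp : Plane → Fin 2 → ℝ) ⁻¹'
      (Set.univ.pi fun _ => Set.Icc (-(1 / 2) : ℝ) (1 / 2)) := by
    ext x
    simp only [unitSquare, Set.mem_ofPred_eq, Set.mem_preimage, Set.mem_univ_pi]
  rw [h, (PiLp.volume_preserving_ofLp (Fin 2)).measure_preimage
    (MeasurableSet.univ_pi fun _ => measurableSet_Icc).nullMeasurableSet, volume_pi_pi]
  norm_num [Real.volume_Icc]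

end Poisson

section Independence

variable {Ω : Type*} [MeasurableSpace Ω] {P : Measure Ω}

theorem indepFun_prodMk_of_indepFun [IsFiniteMeasure P] {α β γ : Type*} [MeasurableSpace α]
    [MeasurableSpace β] [MeasurableSpace γ] {X : Ω → α} {U : Ω → β} {V : Ω → γ}
    (hX : Measurable X) (hU : Measurable U) (hV : Measurable V)
    (hXUV : IndepFun X (fun ω => (U ω, V ω)) P) (hUV : IndepFun U V P) :
    IndepFun U (fun ω => (X ω, V ω)) P := by
  rw [indepFun_iff_map_prod_eq_prod_map_map hU.aemeasurable (hX.prodMk hV).aemeasurable]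
  refine Measure.ext_prod₃ fun {s t u} hs ht hu => ?_
  have hXV : P.map (fun ω => (X ω, V ω)) = (P.map X).prod (P.map V) :=
    (hXUV.comp measurable_id measurable_snd).map_prod_eq_prod_map_map hX.aemeasurable
      hV.aemeasurable
  rw [hXV, Measure.prod_prod, Measure.prod_prod, Measure.map_apply hU hs, Measure.map_apply hX ht,
    Measure.map_apply hV hu, Measure.map_apply (hU.prodMk (hX.prodMk hV)) (hs.prod (ht.prod hu))]
  calc P (U ⁻¹' s ∩ (X ⁻¹' t ∩ V ⁻¹' u))
      = P (X ⁻¹' t ∩ (U ⁻¹' s ∩ V ⁻¹' u)) := by rw [Set.inter_left_comm]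
    _ = P (X ⁻¹' t) * P (U ⁻¹' s ∩ V ⁻¹' u) :=
        hXUV.measure_inter_preimage_eq_mul _ _ ht (hs.prod hu)
    _ = P (U ⁻¹' s) * (P (X ⁻¹' t) * P (V ⁻¹' u)) := by
        rw [hUV.measure_inter_preimage_eq_mul _ _ hs hu, mul_left_comm]

theorem indepFun_update {ι E : Type*} [DecidableEq ι] [MeasurableSpace E] {Z : ι → Ω → E}
    (hZ : ∀ i, Measurable (Z i)) (hind : iIndepFun Z P) (i : ι) (a : E) :
    IndepFun (Z i) (fun ω => Function.update (fun k => Z k ω) i a) P := by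
  have hsup := indep_iSup_of_disjoint (fun k => (hZ k).comap_le) hind (S := {i}) (T := {i}ᶜ)
    disjoint_compl_right
  refine indep_of_indep_of_le_left (indep_of_indep_of_le_right hsup ?_) ?_
  · refine Measurable.comap_le (@measurable_pi_lambda _ _ _ (_) _ _ fun k => ?_)
    obtain rfl | hk := eq_or_ne k i
    · simp only [Function.update_self]
      exact @measurable_const _ _ _ (_) _
    · simp only [Function.update_of_ne hk]
      exact (comap_measurable _).mono (le_iSup₂_of_le k hk le_rfl) le_rfl
  · exact le_iSup₂_of_le i rfl le_rfl

end Independence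

/-- The properties of a marked Poisson process `∑ i, ε_{(X i, Z i)}` of intensity `lam` on which
the analysis of the extended clusters under the Palm probability rests: the points `X i` are
distinct, finitely many of them lie in the unit ball around each of them, on average `lam` of them
lie in the unit square, and their marks are iid with law `μ` and independent of the points. -/
structure IsIIDMarkedProcess {Ω : Type*} [MeasurableSpace Ω] (P : Measure Ω) (lam : ℝ≥0) {n : ℕ}
    (μ : Measure (Mark n)) (X : ℕ → Ω → Plane) (Z : ℕ → Ω → Mark n) : Prop where
  measurable : ∀ i, Measurable (X i)
  ae_injective : ∀ᵐ ω ∂P, Function.Injective fun i => X i ω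
  ae_finite_closedBall : ∀ᵐ ω ∂P, ∀ i, {k | X k ω ∈ Metric.closedBall (X i ω) 1}.Finite
  intensity : ∑' i, P {ω | X i ω ∈ unitSquare} = lam
  measurable_mark : ∀ i, Measurable (Z i)
  law_mark : ∀ i, P.map (Z i) = μ
  iIndep_mark : iIndepFun Z P
  indep_points : IndepFun (fun ω i => X i ω) (fun ω i => Z i ω) P

section Palm

variable {Ω : Type*} [MeasurableSpace Ω] {P : Measure Ω} {lam : ℝ≥0} {n : ℕ}
  {μ : Measure (Mark n)} {X : ℕ → Ω → Plane} {Z : ℕ → Ω → Mark n}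
  {A : Set (Mark n × Config n)} {T : Finset (Fin n)}

theorem IsMarkedPoissonProcess.isIIDMarkedProcess [IsProbabilityMeasure P] {p : I}
    (h : IsMarkedPoissonProcess P lam p X Z) : IsIIDMarkedProcess P lam (markLaw n p) X Z where
  measurable := h.poisson.measurable
  ae_injective := h.poisson.ae_injective
  ae_finite_closedBall := h.poisson.ae_finite_closedBall 1
  intensity := by
    rw [h.poisson.tsum_measure_mem measurableSet_unitSquare (by simp [volume_unitSquare]),
      volume_unitSquare, mul_one]
  measurable_mark := h.measurable_mark
  law_mark := h.law_mark
  iIndep_mark := h.iIndep_mark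
  indep_points := h.indep_points

theorem measurable_seenFrom (i : ℕ) :
    Measurable fun q : (ℕ → Plane) × (ℕ → Mark n) => seenFrom q.1 q.2 i := by
  unfold seenFrom
  fun_prop

theorem measurableSet_mem_unitSquare_and_seenFrom_mem (i : ℕ) (hA : MeasurableSet A) :
    MeasurableSet {q : (ℕ → Plane) × (ℕ → Mark n) |
      q.1 i ∈ unitSquare ∧ seenFrom q.1 q.2 i ∈ A} :=
  (measurableSet_unitSquare.preimage ((measurable_pi_apply i).comp measurable_fst)).inter
    (hA.preimage (measurable_seenFrom i))

theorem measurableSet_extEvent (T : Finset (Fin n)) : MeasurableSet (extEvent T) := by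
  convert measurableSet_iecPackets_eq (0 : Plane) T using 1
  exact Set.ext fun q => mem_extEvent_iff

theorem palm_apply (hX : ∀ i, Measurable (X i)) (hZ : ∀ i, Measurable (Z i))
    (hA : MeasurableSet A) :
    palm P lam X Z A = (lam : ℝ≥0∞)⁻¹ * ∑' i,
      P {ω | X i ω ∈ unitSquare ∧ seenFrom (fun k => X k ω) (fun k => Z k ω) i ∈ A} := by
  rw [palm, Measure.smul_apply, Measure.sum_apply _ hA, smul_eq_mul]
  congr 1
  refine tsum_congr fun i => ?_
  have hseen : Measurable fun ω => (Z i ω, fun k => (X k ω - X i ω, Z k ω)) := by fun_prop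
  rw [Measure.map_apply hseen hA, Measure.restrict_apply (hseen hA), Set.inter_comm]
  rfl

namespace IsIIDMarkedProcess

theorem palm_univ (h : IsIIDMarkedProcess P lam μ X Z) (hlam : 0 < lam) :
    palm P lam X Z Set.univ = 1 := by
  rw [palm_apply h.measurable h.measurable_mark .univ]
  simp only [Set.mem_univ, and_true]
  rw [h.intensity, ENNReal.inv_mul_cancel (by simpa using hlam.ne') ENNReal.coe_ne_top]

theorem indepFun_mark_update [IsProbabilityMeasure P] (h : IsIIDMarkedProcess P lam μ X Z) (i : ℕ)
    (a : Mark n) :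
    IndepFun (Z i) (fun ω => (fun k => X k ω, Function.update (fun k => Z k ω) i a)) P := by
  have hupd : Measurable fun z : ℕ → Mark n => (z i, Function.update z i a) := by fun_prop
  exact indepFun_prodMk_of_indepFun (measurable_pi_iff.2 h.measurable) (h.measurable_mark i)
    (hupd.snd.comp (measurable_pi_iff.2 h.measurable_mark))
    (h.indep_points.comp measurable_id hupd) (indepFun_update h.measurable_mark h.iIndep_mark i a)

theorem measure_mark_inter [IsProbabilityMeasure P] (h : IsIIDMarkedProcess P lam μ X Z)
    (hA : MeasurableSet A) (a : Mark n) (i : ℕ)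
    (hupd : ∀ᵐ ω ∂P, seenFrom (fun k => X k ω) (Function.update (fun k => Z k ω) i a) i ∈ A ↔
      seenFrom (fun k => X k ω) (fun k => Z k ω) i ∈ A) :
    P (Z i ⁻¹' {a} ∩
        {ω | X i ω ∈ unitSquare ∧ seenFrom (fun k => X k ω) (fun k => Z k ω) i ∈ A}) =
      μ {a} * P {ω | X i ω ∈ unitSquare ∧
        seenFrom (fun k => X k ω) (fun k => Z k ω) i ∈ A} := by
  have hae : {ω | X i ω ∈ unitSquare ∧
      seenFrom (fun k => X k ω) (Function.update (fun k => Z k ω) i a) i ∈ A} =ᵐ[P]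
      {ω | X i ω ∈ unitSquare ∧ seenFrom (fun k => X k ω) (fun k => Z k ω) i ∈ A} := by
    filter_upwards [hupd] with ω hω
    exact propext (and_congr_right fun _ => hω)
  rw [← measure_congr (ae_eq_set_inter (Filter.EventuallyEq.refl _ (Z i ⁻¹' {a})) hae),
    ← measure_congr hae, ← h.law_mark i,
    Measure.map_apply (h.measurable_mark i) (measurableSet_singleton a)]
  exact (h.indepFun_mark_update i a).measure_inter_preimage_eq_mul _ _ (measurableSet_singleton a)
    (measurableSet_mem_unitSquare_and_seenFrom_mem i hA)

theorem palm_mark_inter [IsProbabilityMeasure P] (h : IsIIDMarkedProcess P lam μ X Z)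
    (hA : MeasurableSet A) (a : Mark n)
    (hupd : ∀ᵐ ω ∂P, ∀ i,
      seenFrom (fun k => X k ω) (Function.update (fun k => Z k ω) i a) i ∈ A ↔
        seenFrom (fun k => X k ω) (fun k => Z k ω) i ∈ A) :
    palm P lam X Z ({q | q.1 = a} ∩ A) = μ {a} * palm P lam X Z A := by
  have ha : MeasurableSet {q : Mark n × Config n | q.1 = a} :=
    (measurableSet_singleton a).preimage measurable_fst
  rw [palm_apply h.measurable h.measurable_mark (ha.inter hA),
    palm_apply h.measurable h.measurable_mark hA, mul_left_comm,
    ← ENNReal.tsum_mul_left (a := μ {a})]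
  congr 1
  refine tsum_congr fun i => ?_
  rw [← h.measure_mark_inter hA a i (hupd.mono fun ω hω => hω i)]
  exact congrArg P (Set.ext fun ω => and_left_comm)

theorem palm_mark_inter_extEvent [IsProbabilityMeasure P] (h : IsIIDMarkedProcess P lam μ X Z)
    (a : Mark n) :
    palm P lam X Z ({q | q.1 = a} ∩ extEvent T) = μ {a} * palm P lam X Z (extEvent T) := by
  refine h.palm_mark_inter (measurableSet_extEvent T) a ?_
  filter_upwards [h.ae_injective, h.ae_finite_closedBall] with ω hinj hfin i
  rw [mem_extEvent_iff, mem_extEvent_iff, iecPackets_seenFrom_update hinj (hfin i)]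

theorem palmOne_extEvent [IsProbabilityMeasure P] (h : IsIIDMarkedProcess P lam μ X Z)
    (hlam : 0 < lam) (hone : μ {fun _ => true} ≠ 0) :
    palmOne P lam X Z (extEvent T) = palm P lam X Z (extEvent T) := by
  have hmark : palm P lam X Z {q | q.1 = fun _ => true} = μ {fun _ => true} := by
    have hinter := h.palm_mark_inter .univ (fun _ => true) (.of_forall fun ω i => Iff.rfl)
    rwa [Set.inter_univ, h.palm_univ hlam, mul_one] at hinter
  have hfin : μ {fun _ => true} ≠ ∞ := by
    rw [← h.law_mark 0]
    exact measure_ne_top _ _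
  have hset : MeasurableSet {q : Mark n × Config n | q.1 = fun _ => true} :=
    (measurableSet_singleton _).preimage measurable_fst
  rw [palmOne, cond_apply hset, hmark, h.palm_mark_inter_extEvent, ← mul_assoc,
    ENNReal.inv_mul_cancel hone hfin, one_mul]

theorem identDistrib_comp_perm [IsProbabilityMeasure P] (h : IsIIDMarkedProcess P lam μ X Z)
    {e : Equiv.Perm (Fin n)} (he : MeasurePreserving (fun z => z ∘ e) μ μ) :
    IdentDistrib (fun ω => (fun k => X k ω, fun k => Z k ω))
      (fun ω => (fun k => X k ω, fun k => Z k ω ∘ e)) P P := by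
  have hperm : Measurable fun z : ℕ → Mark n => fun k => z k ∘ e :=
    measurable_pi_iff.2 fun k => he.measurable.comp (measurable_pi_apply k)
  have hmark : ∀ k, IdentDistrib (Z k) (fun ω => Z k ω ∘ e) P P := fun k =>
    { aemeasurable_fst := (h.measurable_mark k).aemeasurable
      aemeasurable_snd := (he.measurable.comp (h.measurable_mark k)).aemeasurable
      map_eq := by
        rw [h.law_mark k]
        nth_rw 1 [← he.map_eq]
        rw [← h.law_mark k, Measure.map_map he.measurable (h.measurable_mark k)]
        rfl }
  exact (IdentDistrib.refl (measurable_pi_iff.2 h.measurable).aemeasurable).prodMk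
    (IdentDistrib.pi hmark h.iIndep_mark (h.iIndep_mark.comp _ fun _ => he.measurable))
    h.indep_points (h.indep_points.comp measurable_id hperm)

theorem palm_extEvent_map [IsProbabilityMeasure P] (h : IsIIDMarkedProcess P lam μ X Z)
    {e : Equiv.Perm (Fin n)} (he : MeasurePreserving (fun z => z ∘ e) μ μ) :
    palm P lam X Z (extEvent (T.map e.toEmbedding)) = palm P lam X Z (extEvent T) := by
  rw [palm_apply h.measurable h.measurable_mark (measurableSet_extEvent _),
    palm_apply h.measurable h.measurable_mark (measurableSet_extEvent _)]
  congr 1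
  refine tsum_congr fun i => ?_
  refine Eq.trans (congrArg P (Set.ext fun ω => and_congr_right fun _ => ?_))
    ((h.identDistrib_comp_perm he).measure_mem_eq
      (measurableSet_mem_unitSquare_and_seenFrom_mem i (measurableSet_extEvent T))).symm
  rw [mem_extEvent_iff, mem_extEvent_iff, ← map_iecPackets_seenFrom_comp_perm e,
    Finset.map_inj]

theorem palm_extEvent_of_card_eq [IsProbabilityMeasure P] (h : IsIIDMarkedProcess P lam μ X Z)
    (hexch : ∀ e : Equiv.Perm (Fin n), MeasurePreserving (fun z => z ∘ e) μ μ)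
    {S : Finset (Fin n)} (hST : S.card = T.card) :
    palm P lam X Z (extEvent S) = palm P lam X Z (extEvent T) := by
  let e : Equiv.Perm (Fin n) := (Finset.equivOfCardEq hST).extendSubtype
  have hmap : S.map e.toEmbedding = T := by
    refine Finset.eq_of_subset_of_card_le (fun j hj => ?_) (by rw [Finset.card_map, hST])
    obtain ⟨k, hk, rfl⟩ := Finset.mem_map.1 hj
    exact (Finset.equivOfCardEq hST).extendSubtype_mem k hk
  rw [← hmap, h.palm_extEvent_map (hexch e)]

end IsIIDMarkedProcess

end Palm

section MarkLaw

theorem measurePreserving_comp_perm_markLaw {n : ℕ} (p : I) (e : Equiv.Perm (Fin n)) :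
    MeasurePreserving (fun z => z ∘ e) (markLaw n p) (markLaw n p) :=
  measurePreserving_arrowCongr' _ _ e.symm (MeasurableEquiv.refl Bool) fun _ =>
    MeasurePreserving.id _

theorem markLaw_singleton_true_ne_zero (n : ℕ) {p : I} (hp : 0 < p) :
    markLaw n p {fun _ => true} ≠ 0 := by
  rw [markLaw, Measure.pi_singleton, Finset.prod_ne_zero_iff]
  intro j _
  rw [bernoulliMeasure_apply_of_mem_of_notMem p (measurableSet_singleton _) (by simp) (by simp)]
  exact_mod_cast (show unitInterval.toNNReal p ≠ 0 from
    fun h0 => hp.ne' (Subtype.ext (congrArg NNReal.toReal h0)))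

end MarkLaw

theorem choose_mul_measureReal_eq_sub {Ω α : Type*} [MeasurableSpace Ω] [Fintype α]
    {μ : Measure Ω} [IsFiniteMeasure μ] {S : Ω → Finset α} {T : Finset α}
    (hS : ∀ T', MeasurableSet {ω | S ω = T'})
    (hcard : ∀ T', T'.card = T.card → μ {ω | S ω = T'} = μ {ω | S ω = T}) :
    (Fintype.card α).choose T.card * μ.real {ω | S ω = T} =
      μ.real {ω | T.card ≤ (S ω).card} - μ.real {ω | T.card + 1 ≤ (S ω).card} := by
  have hset : {ω | (S ω).card = T.card} =
      S ⁻¹' (Finset.univ.powersetCard T.card : Finset (Finset α)) := by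
    ext ω
    simp
  have hmeas : MeasurableSet {ω | (S ω).card = T.card} := by
    rw [hset, ← Set.biUnion_preimage_singleton]
    exact Finset.measurableSet_biUnion _ fun T' _ => hS T'
  have hfib : μ.real {ω | (S ω).card = T.card} =
      (Fintype.card α).choose T.card * μ.real {ω | S ω = T} := by
    have hconst : ∀ T' ∈ Finset.univ.powersetCard T.card,
        μ.real (S ⁻¹' {T'}) = μ.real {ω | S ω = T} := fun T' hT' =>
      congrArg ENNReal.toReal (hcard T' (Finset.mem_powersetCard_univ.1 hT'))
    rw [hset, ← sum_measureReal_preimage_singleton _ fun T' _ => hS T',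
      Finset.sum_eq_card_nsmul hconst, Finset.card_powersetCard, Finset.card_univ, nsmul_eq_mul]
  rw [← hfib, ← measureReal_inter_add_sdiff (s := {ω | T.card ≤ (S ω).card}) hmeas,
    Set.inter_eq_right.2 fun ω hω => hω.ge, add_sub_assoc, left_eq_add, sub_eq_zero]
  congr 1
  ext ω
  simp only [Set.mem_sdiff, Set.mem_ofPred_eq, Order.add_one_le_iff, lt_iff_le_and_ne, ne_comm]

theorem card_firstPackets {n t : ℕ} (ht : t ≤ n) : (firstPackets n t).card = t := by
  simp [firstPackets, Fin.card_filter_val_lt, ht]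

section Theta

variable {Ω : Type*} [MeasurableSpace Ω] {P : Measure Ω} {lam : ℝ≥0} {n : ℕ}
  {μ : Measure (Mark n)} {X : ℕ → Ω → Plane} {Z : ℕ → Ω → Mark n}

theorem thetaExt_eq (k : ℕ) : thetaExt P lam X Z k =
    (palm P lam X Z).real {q | k ≤ (iecPackets (Set.range q.2) 0).card} := by
  simp only [thetaExt, mem_extAtLeast_iff]

theorem thetaExt_succ_self : thetaExt P lam X Z (n + 1) = 0 := by
  have hempty : {q : Mark n × Config n | n + 1 ≤ (iecPackets (Set.range q.2) 0).card} = ∅ :=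
    Set.eq_empty_of_forall_notMem fun q hq => (card_finset_fin_le _).not_gt hq
  rw [thetaExt_eq, hempty, measureReal_empty]

theorem IsIIDMarkedProcess.choose_mul_palm_extEvent [IsProbabilityMeasure P]
    (h : IsIIDMarkedProcess P lam μ X Z) (hlam : 0 < lam)
    (hexch : ∀ e : Equiv.Perm (Fin n), MeasurePreserving (fun z => z ∘ e) μ μ)
    (T : Finset (Fin n)) :
    n.choose T.card * (palm P lam X Z).real (extEvent T) =
      thetaExt P lam X Z T.card - thetaExt P lam X Z (T.card + 1) := by
  have hfin : IsFiniteMeasure (palm P lam X Z) := ⟨by simp [h.palm_univ hlam]⟩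
  have hext : ∀ T', extEvent T' =
      {q : Mark n × Config n | iecPackets (Set.range q.2) 0 = T'} := fun T' =>
    Set.ext fun q => mem_extEvent_iff
  have hcount := choose_mul_measureReal_eq_sub (μ := palm P lam X Z)
    (T := T) (measurableSet_iecPackets_eq 0) fun T' hT' => by
      simpa only [hext] using h.palm_extEvent_of_card_eq hexch hT'
  rwa [Fintype.card_fin, ← hext, ← thetaExt_eq, ← thetaExt_eq] at hcount

end Theta

theorem proposition1_general {Ω : Type*} [MeasurableSpace Ω] {P : Measure Ω}
    [IsProbabilityMeasure P] {n : ℕ} {lam : ℝ≥0} (hlam : 0 < lam) {μ : Measure (Mark n)}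
    (hone : μ {fun _ => true} ≠ 0)
    (hexch : ∀ e : Equiv.Perm (Fin n), MeasurePreserving (fun z => z ∘ e) μ μ)
    {X : ℕ → Ω → Plane} {Z : ℕ → Ω → Mark n} (hXZ : IsIIDMarkedProcess P lam μ X Z) (t : ℕ) :
    (t < n → (palmOne P lam X Z).real (extEvent (firstPackets n t)) =
      (thetaExt P lam X Z t - thetaExt P lam X Z (t + 1)) / (n.choose t : ℝ)) ∧
    (t = n → (palmOne P lam X Z).real (extEvent (firstPackets n t)) = thetaExt P lam X Z n) ∧
    (∀ T : Finset (Fin n), T.card = t → (palmOne P lam X Z).real (extEvent T) =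
      (palmOne P lam X Z).real (extEvent (firstPackets n t))) := by
  have hpalm : ∀ T : Finset (Fin n),
      (palmOne P lam X Z).real (extEvent T) = (palm P lam X Z).real (extEvent T) := fun T =>
    congrArg ENNReal.toReal (hXZ.palmOne_extEvent hlam hone)
  have hchoose : t ≤ n → n.choose t * (palm P lam X Z).real (extEvent (firstPackets n t)) =
      thetaExt P lam X Z t - thetaExt P lam X Z (t + 1) := fun ht => by
    simpa only [card_firstPackets ht] using
      hXZ.choose_mul_palm_extEvent hlam hexch (firstPackets n t)
  refine ⟨fun ht => ?_, ?_, fun T hT => ?_⟩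
  · have hpos : (n.choose t : ℝ) ≠ 0 := Nat.cast_ne_zero.2 (Nat.choose_pos ht.le).ne'
    rw [hpalm, eq_div_iff hpos, mul_comm, hchoose ht.le]
  · rintro rfl
    simpa [hpalm, thetaExt_succ_self] using hchoose le_rfl
  · rw [hpalm, hpalm, measureReal_def, measureReal_def, hXZ.palm_extEvent_of_card_eq hexch]
    rw [card_firstPackets (hT ▸ card_finset_fin_le T), hT]

end Forwarding

theorem proposition1 {Ω : Type*} [MeasurableSpace Ω] (P : Measure Ω) [IsProbabilityMeasure P]
    (n : ℕ) (lam : ℝ≥0) (hlam : 0 < lam) (p : I) (hp : 0 < p)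
    (X : ℕ → Ω → Forwarding.Plane) (Z : ℕ → Ω → Forwarding.Mark n)
    (hXZ : Forwarding.IsMarkedPoissonProcess P lam p X Z) (t : ℕ) :
    (t < n →
      (Forwarding.palmOne P lam X Z).real (Forwarding.extEvent (Forwarding.firstPackets n t)) =
        (Forwarding.thetaExt P lam X Z t - Forwarding.thetaExt P lam X Z (t + 1)) /
          (n.choose t : ℝ)) ∧
    (t = n →
      (Forwarding.palmOne P lam X Z).real (Forwarding.extEvent (Forwarding.firstPackets n t)) =
        Forwarding.thetaExt P lam X Z n) ∧
    (∀ T : Finset (Fin n), T.card = t →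
      (Forwarding.palmOne P lam X Z).real (Forwarding.extEvent T) =
        (Forwarding.palmOne P lam X Z).real
          (Forwarding.extEvent (Forwarding.firstPackets n t))) :=
  Forwarding.proposition1_general hlam (Forwarding.markLaw_singleton_true_ne_zero n hp)
    (Forwarding.measurePreserving_comp_perm_markLaw p) hXZ.isIIDMarkedProcess t
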